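/- Let $\mathbf k$ be a field and let $S=\mathbf k[x_{l,j} : 1\le l\le k,\ 0\le j\le N_l]$ (with integers $N_l\ge 0$) be the standard $\mathbb N^k$-graded polynomial ring, where $\deg x_{l,j}=\mathbf e_l$. Let $\mathfrak M_l$ be the ideal of $S$ generated by $x_{l,0},\dots,x_{l,N_l}$, and let $\mathfrak M=\sum_{l=1}^k\mathfrak M_l$. Let $F$ be a finitely generated $\mathbb Z^k$-graded $S$-module. For an ideal $U$ of $S$ generated by homogeneous elements, $H^i_U$ denotes local cohomology in the category of $\mathbb Z^k$-graded $S$-modules, i.e. the $i$-th right derived functor of $\Gamma_U(G)=\{x\in G : U^t x=0 \text{ for some } t\}$, so that $H^i_U(F)$ is again $\mathbb Z^k$-graded. For $1\le l\le k$ and $i\ge 0$ put $$a_{l,i}(F)=\max\{\,n_l \mid \mathbf n=(n_1,\dots,n_k)\in\mathbb Z^k,\ H^i_{\mathfrak M}(F)_{\mathbf n}\neq 0\,\},$$ with $a_{l,i}(F)=-\infty$ if $H^i_{\mathfrak M}(F)=0$, and $a_{l,*}(F)=\max_{i\ge 0} a_{l,i}(F)$; the $a^*$-invariant vector of $F$ is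 $\mathfrak a^*_{\mathbb V}(F)=(a_{1,*}(F),\dots,a_{k,*}(F))$. For disjoint sets $I,J\subseteq\{1,\dots,k\}$ let $$\mathfrak M_{I,J}=\Big(\bigcap_{i\in I}\mathfrak M_i\Big)\cap\Big(\sum_{j\in J}\mathfrak M_j\Big),$$ where an empty intersection is $S$ and where the second factor is omitted if $J=\emptyset$ (so $\mathfrak M_{I,\emptyset}=\bigcap_{i\in I}\mathfrak M_i$ and $\mathfrak M_{\emptyset,\emptyset}=S$). Then for every $\mathbf n\in\mathbb Z^k$ with $\mathbf n\ge\mathfrak a^*_{\mathbb V}(F)+\mathbf 1$ (that is, $n_l\ge a_{l,*}(F)+1$ for all $l$), every $i\ge 0$ and any two disjoint sets $I,J\subseteq\{1,\dots,k\}$, $$H^i_{\mathfrak M_{I,J}}(F)_{\mathbf n}=0 .$$ -/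

import Mathlib

open CategoryTheory

universe u

noncomputable section

namespace MultigradedLC

/-! ### The standard multigraded polynomial ring

`k` is the number of blocks of variables and the `l`-th block has `N l + 1` variables, i.e. the ring
is the homogeneous coordinate ring of `ℙ^{N_1} × ⋯ × ℙ^{N_k}`. -/

/-- The index set of the variables: pairs (block, position in the block). -/
abbrev Var {k : ℕ} (N : Fin k → ℕ) : Type := Σ l : Fin k, Fin (N l + 1)

/-- The multidegree of a variable: the `l`-th basis vector for a variable of the `l`-th block. -/
def varDeg {k : ℕ} (N : Fin k → ℕ) (x : Var N) : Fin k → ℤ := Pi.single x.1 1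

/-- The multidegree of the monomial with exponent vector `s`. -/
abbrev monDeg {k : ℕ} (N : Fin k → ℕ) : (Var N →₀ ℕ) →+ (Fin k → ℤ) :=
  Finsupp.weight (varDeg N)

/-- The polynomial ring `S`. -/
abbrev PolyRing (𝕜 : Type u) [Field 𝕜] {k : ℕ} (N : Fin k → ℕ) : Type u :=
  MvPolynomial (Var N) 𝕜

/-- The `ℤ^k`-grading of `S` (the pieces outside `ℕ^k` vanish). -/
abbrev polyGrading (𝕜 : Type u) [Field 𝕜] {k : ℕ} (N : Fin k → ℕ) :
    (Fin k → ℤ) → Submodule 𝕜 (PolyRing 𝕜 N) :=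
  MvPolynomial.weightedHomogeneousSubmodule 𝕜 (varDeg N)

/-! ### The ideals -/

/-- The ideal generated by the `l`-th block of variables. -/
def blockIdeal (𝕜 : Type u) [Field 𝕜] {k : ℕ} (N : Fin k → ℕ) (l : Fin k) :
    Ideal (PolyRing 𝕜 N) :=
  Ideal.span (Set.range fun j : Fin (N l + 1) => MvPolynomial.X (⟨l, j⟩ : Var N))

/-- The ideal `𝔐 = ∑ 𝔐_l`, generated by all variables. -/
def maxIdeal (𝕜 : Type u) [Field 𝕜] {k : ℕ} (N : Fin k → ℕ) : Ideal (PolyRing 𝕜 N) :=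
  ⨆ l, blockIdeal 𝕜 N l

/-- The ideal `𝔐_{I,J} = (⋂_{i ∈ I} 𝔐_i) ∩ (∑_{j ∈ J} 𝔐_j)`, where the second factor is absent
when `J` is empty (so that `𝔐_{I,∅} = ⋂_{i ∈ I} 𝔐_i`). -/
def mixedIdeal (𝕜 : Type u) [Field 𝕜] {k : ℕ} (N : Fin k → ℕ) (I J : Finset (Fin k)) :
    Ideal (PolyRing 𝕜 N) :=
  (⨅ i ∈ I, blockIdeal 𝕜 N i) ⊓ (if J = ∅ then ⊤ else ⨆ j ∈ J, blockIdeal 𝕜 N j)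

/-! ### The category of `ℤ^k`-graded `S`-modules

A `ℤ^k`-graded `S`-module is a family of `𝕜`-vector spaces `G_n` (`n ∈ ℤ^k`) with, for each monomial
`X^s`, multiplication maps `G_m → G_{m + deg s}`, such that `X^0` acts as the identity and
`X^(s+t)` as the composite of `X^s` and `X^t`. In other words, it is a functor to `𝕜`-vector spaces
from the category with object set `ℤ^k` in which a morphism `m ⟶ n` is a monomial of degree
`n - m`. Degree-preserving `S`-linear maps are the natural transformations. -/

/-- The objects of the indexing category: multidegrees. -/
structure MDeg {k : ℕ} (N : Fin k → ℕ) where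
  /-- the underlying vector of integers -/
  deg : Fin k → ℤ

/-- A morphism `m ⟶ n` is (the exponent vector of) a monomial of degree `n - m`;
composition is multiplication of monomials. -/
instance {k : ℕ} (N : Fin k → ℕ) : SmallCategory (MDeg N) where
  Hom m n := {s : Var N →₀ ℕ // m.deg + monDeg N s = n.deg}
  id m := ⟨0, by simp⟩
  comp s t := ⟨s.1 + t.1, by rw [map_add, ← add_assoc, s.2, t.2]⟩
  id_comp s := Subtype.ext (zero_add s.1)
  comp_id s := Subtype.ext (add_zero s.1)
  assoc r s t := Subtype.ext (add_assoc r.1 s.1 t.1)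

/-- Multiplication by the monomial with exponent vector `s`, as a morphism out of `m`. -/
def monHom {k : ℕ} (N : Fin k → ℕ) (m : MDeg N) (s : Var N →₀ ℕ) :
    m ⟶ (⟨m.deg + monDeg N s⟩ : MDeg N) :=
  ⟨s, rfl⟩

/-- The category of `ℤ^k`-graded `S`-modules and degree-preserving homomorphisms. -/
abbrev GrMod (𝕜 : Type u) [Field 𝕜] {k : ℕ} (N : Fin k → ℕ) : Type (u + 1) :=
  MDeg N ⥤ ModuleCat.{u} 𝕜

/-- The category of graded modules has enough injectives. -/
instance (𝕜 : Type u) [Field 𝕜] {k : ℕ} (N : Fin k → ℕ) : EnoughInjectives (GrMod 𝕜 N) := by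
  let C : Type u := ULiftHom.{u} (ULift.{u} (MDeg N))
  let e₁ : (MDeg N ⥤ ModuleCat.{u} 𝕜) ≌ (C ⥤ ModuleCat.{u} 𝕜) :=
    (ULiftHomULiftCategory.equiv.{u, u} (MDeg N)).congrLeft
  let e₂ : (C ⥤ ModuleCat.{u} 𝕜) ≌ (Cᵒᵖᵒᵖ ⥤ ModuleCat.{u} 𝕜) :=
    (opOpEquivalence C).symm.congrLeft
  let e₃ : (Cᵒᵖᵒᵖ ⥤ ModuleCat.{u} 𝕜) ≌ Sheaf (⊥ : GrothendieckTopology Cᵒᵖ) (ModuleCat.{u} 𝕜) :=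
    (sheafBotEquivalence (ModuleCat.{u} 𝕜)).symm
  exact EnoughInjectives.of_equivalence ((e₁.trans e₂).trans e₃).functor

instance {k : ℕ} (N : Fin k → ℕ) : DecidableEq (MDeg N) := fun m n =>
  decidable_of_iff (m.deg = n.deg) ⟨fun h => by cases m; cases n; simp_all, fun h => by rw [h]⟩

section

variable {𝕜 : Type u} [Field 𝕜] {k : ℕ} {N : Fin k → ℕ}

/-- The total space `⨁ G_n` of a graded module. -/
abbrev Total (G : GrMod 𝕜 N) : Type u := DirectSum (MDeg N) fun n => G.obj n

/-- The inclusion of the `n`-th graded piece in the total space. -/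
abbrev incl (G : GrMod 𝕜 N) (n : MDeg N) : G.obj n →ₗ[𝕜] Total G :=
  DirectSum.lof 𝕜 (MDeg N) (fun n => G.obj n) n

/-- Multiplication by a monomial on the total space of a graded module. -/
def monEnd (G : GrMod 𝕜 N) (s : Var N →₀ ℕ) : Module.End 𝕜 (Total G) :=
  DirectSum.toModule 𝕜 (MDeg N) _ fun m =>
    incl G ⟨m.deg + monDeg N s⟩ ∘ₗ (G.map (monHom N m s)).hom

theorem monEnd_incl (G : GrMod 𝕜 N) {m n : MDeg N} (s : m ⟶ n) (x : G.obj m) :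
    monEnd G s.1 (incl G m x) = incl G n ((G.map s).hom x) := by
  obtain ⟨n⟩ := n
  obtain ⟨s, hs⟩ := s
  obtain rfl : m.deg + monDeg N s = n := hs
  simp only [monEnd, incl, DirectSum.toModule_lof]
  rfl

/-- The action of `S` on the total space of a graded module, making it an `S`-module. -/
def polyAct (G : GrMod 𝕜 N) : PolyRing 𝕜 N →ₐ[𝕜] Module.End 𝕜 (Total G) :=
  AddMonoidAlgebra.lift 𝕜 (Module.End 𝕜 (Total G)) (Var N →₀ ℕ)
    { toFun := fun s => monEnd G s.toAdd
      map_one' := by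
        refine DirectSum.linearMap_ext _ fun m => LinearMap.ext fun x => ?_
        have h := monEnd_incl G (𝟙 m) x
        rw [G.map_id] at h
        exact h
      map_mul' := fun s t => by
        refine DirectSum.linearMap_ext _ fun m => LinearMap.ext fun x => ?_
        have h₁ := monEnd_incl G (monHom N m t.toAdd) x
        have h₂ := monEnd_incl G (monHom N _ s.toAdd) ((G.map (monHom N m t.toAdd)).hom x)
        have h₃ := monEnd_incl G (monHom N m t.toAdd ≫ monHom N _ s.toAdd) x
        rw [G.map_comp] at h₃
        rw [mul_comm s t]
        exact h₃.trans (h₂.symm.trans (congrArg (monEnd G s.toAdd) h₁.symm)) }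

theorem polyAct_monomial (G : GrMod 𝕜 N) (s : Var N →₀ ℕ) (c : 𝕜) :
    polyAct G (MvPolynomial.monomial s c) = c • monEnd G s := by
  exact AddMonoidAlgebra.lift_single _ _ _

/-- The map on total spaces induced by a homomorphism of graded modules. -/
def totalMap {G G' : GrMod 𝕜 N} (f : G ⟶ G') : Total G →ₗ[𝕜] Total G' :=
  DirectSum.toModule 𝕜 (MDeg N) _ fun n => incl G' n ∘ₗ (f.app n).hom

theorem totalMap_incl {G G' : GrMod 𝕜 N} (f : G ⟶ G') (n : MDeg N) (x : G.obj n) :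
    totalMap f (incl G n x) = incl G' n ((f.app n).hom x) := by
  simp [totalMap, incl, DirectSum.toModule_lof]

theorem totalMap_polyAct {G G' : GrMod 𝕜 N} (f : G ⟶ G') (p : PolyRing 𝕜 N) :
    totalMap f ∘ₗ polyAct G p = polyAct G' p ∘ₗ totalMap f := by
  have h : ∀ (s : Var N →₀ ℕ) (c : 𝕜),
      totalMap f ∘ₗ polyAct G (MvPolynomial.monomial s c) =
        polyAct G' (MvPolynomial.monomial s c) ∘ₗ totalMap f := by
    intro s c
    rw [polyAct_monomial, polyAct_monomial, LinearMap.comp_smul, LinearMap.smul_comp]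
    congr 1
    refine DirectSum.linearMap_ext _ fun m => LinearMap.ext fun x => ?_
    have h₁ := monEnd_incl G (monHom N m s) x
    have h₂ := monEnd_incl G' (monHom N m s) ((f.app m).hom x)
    have h₃ := congrArg (fun g => g.hom x) (f.naturality (monHom N m s))
    change totalMap f (monEnd G s (incl G m x)) = monEnd G' s (totalMap f (incl G m x))
    rw [totalMap_incl]
    refine (congrArg (totalMap f) h₁).trans ((totalMap_incl f _ _).trans ?_)
    exact (congrArg (incl G' _) h₃).trans h₂.symm
  rw [← MvPolynomial.support_sum_monomial_coeff p]
  simp only [map_sum]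
  ext1 m
  ext1 x
  simp only [LinearMap.comp_apply, LinearMap.sum_apply, map_sum]
  refine Finset.sum_congr rfl fun s _ => ?_
  exact LinearMap.congr_fun (h s _) _

/-- The degree-`n` piece of the `U`-torsion submodule `Γ_U(G)`: the elements of `G_n` that are
annihilated by some power of the ideal `U`. -/
def torsionPiece (U : Ideal (PolyRing 𝕜 N)) (G : GrMod 𝕜 N) (n : MDeg N) :
    Submodule 𝕜 (G.obj n) where
  carrier := {x | ∃ t : ℕ, ∀ p ∈ U ^ t, polyAct G p (incl G n x) = 0}
  zero_mem' := ⟨0, fun p _ => by simp⟩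
  add_mem' := by
    rintro x y ⟨a, ha⟩ ⟨b, hb⟩
    refine ⟨a + b, fun p hp => ?_⟩
    rw [map_add, map_add, ha p (Ideal.pow_le_pow_right (Nat.le_add_right a b) hp),
      hb p (Ideal.pow_le_pow_right (Nat.le_add_left b a) hp), add_zero]
  smul_mem' := by
    rintro c x ⟨a, ha⟩
    exact ⟨a, fun p hp => by rw [map_smul, map_smul, ha p hp, smul_zero]⟩

theorem map_mem_torsionPiece (U : Ideal (PolyRing 𝕜 N)) (G : GrMod 𝕜 N) {m n : MDeg N}
    (s : m ⟶ n) {x : G.obj m} (hx : x ∈ torsionPiece U G m) :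
    (G.map s).hom x ∈ torsionPiece U G n := by
  obtain ⟨t, ht⟩ := hx
  refine ⟨t, fun p hp => ?_⟩
  have h : monEnd G s.1 = polyAct G (MvPolynomial.monomial s.1 1) := by
    rw [polyAct_monomial, one_smul]
  rw [← monEnd_incl, h, ← Module.End.mul_apply, ← map_mul, mul_comm, map_mul,
    Module.End.mul_apply, ht p hp, map_zero]

theorem app_mem_torsionPiece (U : Ideal (PolyRing 𝕜 N)) {G G' : GrMod 𝕜 N} (f : G ⟶ G')
    (n : MDeg N) {x : G.obj n} (hx : x ∈ torsionPiece U G n) :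
    (f.app n).hom x ∈ torsionPiece U G' n := by
  obtain ⟨t, ht⟩ := hx
  refine ⟨t, fun p hp => ?_⟩
  rw [← totalMap_incl, ← LinearMap.comp_apply, ← totalMap_polyAct, LinearMap.comp_apply,
    ht p hp, map_zero]

/-- The `U`-torsion functor `Γ_U` on graded modules. -/
def torsion (U : Ideal (PolyRing 𝕜 N)) : GrMod 𝕜 N ⥤ GrMod 𝕜 N where
  obj G :=
    { obj := fun n => ModuleCat.of 𝕜 (torsionPiece U G n)
      map := fun s => ModuleCat.ofHom
        ((G.map s).hom.restrict fun _ hx => map_mem_torsionPiece U G s hx)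
      map_id := fun n => by
        ext x
        exact congrArg (fun g => g.hom x.1) (G.map_id n)
      map_comp := fun s t => by
        ext x
        exact congrArg (fun g => g.hom x.1) (G.map_comp s t) }
  map f :=
    { app := fun n => ModuleCat.ofHom
        ((f.app n).hom.restrict fun _ hx => app_mem_torsionPiece U f n hx)
      naturality := fun m n s => by
        ext x
        exact congrArg (fun g => g.hom x.1) (f.naturality s) }
  map_id G := by ext n x; rfl
  map_comp f g := by ext n x; rfl

instance (U : Ideal (PolyRing 𝕜 N)) : (torsion U).Additive where
  map_add := by intros; ext n x; rfl

/-- The `i`-th local cohomology functor `H^i_U` on graded modules: the `i`-th right derived functor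
of `Γ_U`. -/
def localCoh (U : Ideal (PolyRing 𝕜 N)) (i : ℕ) : GrMod 𝕜 N ⥤ GrMod 𝕜 N :=
  (torsion U).rightDerived i

end

/-! ### Graded modules over `S`, their local cohomology and the `a^*`-invariant vector -/

section

variable {𝕜 : Type u} [Field 𝕜] {k : ℕ} (N : Fin k → ℕ)
  {F : Type u} [AddCommGroup F] [Module 𝕜 F] [Module (PolyRing 𝕜 N) F]
  (𝓕 : (Fin k → ℤ) → Submodule 𝕜 F) [SetLike.GradedSMul (polyGrading 𝕜 N) 𝓕]

theorem monomial_smul_mem {m n : MDeg N} (s : m ⟶ n) {x : F} (hx : x ∈ 𝓕 m.deg) :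
    (MvPolynomial.monomial s.1 (1 : 𝕜) : PolyRing 𝕜 N) • x ∈ 𝓕 n.deg := by
  have h : (MvPolynomial.monomial s.1 (1 : 𝕜) : PolyRing 𝕜 N) ∈ polyGrading 𝕜 N (monDeg N s.1) :=
    MvPolynomial.isWeightedHomogeneous_monomial _ _ _ rfl
  have h' := SetLike.GradedSMul.smul_mem (B := 𝓕) h hx
  rwa [vadd_eq_add, add_comm, s.2] at h'

variable [IsScalarTower 𝕜 (PolyRing 𝕜 N) F]

/-- An `S`-module `F` with a grading `F = ⨁ 𝓕 n` as an object of the category of graded modules. -/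
def toGrMod : GrMod 𝕜 N where
  obj n := ModuleCat.of 𝕜 (𝓕 n.deg)
  map s := ModuleCat.ofHom
    ((Algebra.lsmul 𝕜 𝕜 F (MvPolynomial.monomial s.1 (1 : 𝕜) : PolyRing 𝕜 N)).restrict
      fun _ hx => monomial_smul_mem N 𝓕 s hx)
  map_id n := by
    ext x
    exact one_smul (PolyRing 𝕜 N) x.1
  map_comp s t := by
    ext x
    change (MvPolynomial.monomial (s.1 + t.1) (1 : 𝕜) : PolyRing 𝕜 N) • x.1 =
      (MvPolynomial.monomial t.1 (1 : 𝕜) : PolyRing 𝕜 N) •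
        (MvPolynomial.monomial s.1 (1 : 𝕜) : PolyRing 𝕜 N) • x.1
    rw [smul_smul, MvPolynomial.monomial_mul, add_comm, one_mul]

/-- The graded piece `H^i_U(F)_n` of the local cohomology of a graded module `F`. -/
def localCohPiece (U : Ideal (PolyRing 𝕜 N)) (i : ℕ) (n : Fin k → ℤ) : ModuleCat.{u} 𝕜 :=
  ((localCoh U i).obj (toGrMod N 𝓕)).obj ⟨n⟩

/-- `a_{l,i}(F)`, the largest `l`-th coordinate of a multidegree `n` with `H^i_𝔐(F)_n ≠ 0`,
with value `-∞` if there is none. It is written as a supremum in `ℤ ∪ {±∞}`, which is the maximum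
whenever the set of these coordinates is non-empty and bounded above. -/
def aInv (l : Fin k) (i : ℕ) : WithBot (WithTop ℤ) :=
  ⨆ (n : Fin k → ℤ) (_ : Nontrivial (localCohPiece N 𝓕 (maxIdeal 𝕜 N) i n)),
    ((n l : WithTop ℤ) : WithBot (WithTop ℤ))

/-- `a_{l,*}(F) = max_i a_{l,i}(F)`, the `l`-th coordinate of the `a^*`-invariant vector. -/
def aStar (l : Fin k) : WithBot (WithTop ℤ) :=
  ⨆ i : ℕ, aInv N 𝓕 l i

end

end MultigradedLC

end

/-!
Let `0 → E_1 → E_2 → ⋯` be an injective resolution of the graded module `F`. A graded piece of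
`H^i_U(F)` vanishes if and only if every `U`-torsion cycle of the resolution in that degree is the
boundary of a `U`-torsion element, and for the ideals at hand torsion can be tested on monomials
(`torsionPiece_iInf`). The whole argument is therefore a diagram chase with elements; it does not
use that the two index sets are disjoint. For a set `A` of variables let `𝔪_A` be the ideal that it
generates.

*Ingredients from injectivity.* An injective graded module `E` has the extension property with
respect to quotients of shifts of `S` by monomial ideals. Hence in `E` an equation `s • w = z` with
a monomial `s` can be solved by some `w` annihilated by a monomial ideal `𝔭` if `z` is annihilated
by `𝔭 : s` (`exists_act_eq`), and an element annihilated by `𝔭 ∩ 𝔮` is the sum of one annihilated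
by `𝔭` and one annihilated by `𝔮` (`exists_add_eq`).

*Sums of blocks.* Let `A` be the set of variables of the blocks in a non-empty set `J`, let `j ∈ J`,
and let `D` be the set of degrees `m` with `n_j ≤ m_j`. By the definition of the `a^*`-invariant
vector, `H^i_𝔐(F)` vanishes in all degrees in `D`, and `D` is stable under shifts by the degrees of
the variables outside `A`. If a variable `v` acts surjectively on the terms of a complex, the
acyclicity of the complex in `D` passes to its subcomplex of elements annihilated by `v`
(`InjComplex.acyclic_insert_right`). So the `𝔐`-torsion elements annihilated by all variables
outside `A` form an acyclic complex in `D`, and these are also the `𝔪_A`-torsion elements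
annihilated by the variables outside `A`. A Nakayama argument removes the condition of being
annihilated by the variables outside `A`, one variable at a time
(`InjComplex.acyclic_of_insert_right`). It needs that the cohomology is bounded below in the
direction of the degrees outside `J`. This holds for `F`, which is finitely generated
(`exists_forall_lt_eq_bot`), and is inherited by the `𝔪_A`-torsion, since the variables in `A` have
degree zero in this direction (`InjComplex.acyclic_insert_left`). The result is that
`H^i_{𝔪_A}(F)` vanishes in the degrees in `D` (`InjComplex.acyclic_of_acyclic_univ`).

*Intersections.* The Mayer–Vietoris argument (`InjComplex.acyclic_cons`) and the fact that
`𝔪_A + ⋂ 𝔪_B` has the same radical as `⋂ 𝔪_{A ∪ B}` extend the vanishing in degree `n` to all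
finite intersections of the ideals `𝔪_A`, where `A` is a non-empty union of blocks
(`InjComplex.acyclic_powFilt_of_forall`). The ideals `𝔐_{I,J}` are of this form.
-/

namespace MultigradedLC

variable {𝕜 : Type u} [Field 𝕜] {k : ℕ} {N : Fin k → ℕ}

/-! ### Cyclic monomial modules and the extension property of injective graded modules -/

/-- Multiplication by a monomial between two graded pieces, as a linear map. -/
def act (G : GrMod 𝕜 N) {m n : MDeg N} (s : m ⟶ n) : G.obj m →ₗ[𝕜] G.obj n := (G.map s).hom

theorem act_comp (G : GrMod 𝕜 N) {m n p : MDeg N} (s : m ⟶ n) (t : n ⟶ p) (x : G.obj m) :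
    act G (s ≫ t) x = act G t (act G s x) := by
  simp [act]

theorem act_id (G : GrMod 𝕜 N) {m : MDeg N} (x : G.obj m) : act G (𝟙 m) x = x := by
  simp [act]

theorem app_act {G G' : GrMod 𝕜 N} (f : G ⟶ G') {m n : MDeg N} (s : m ⟶ n) (x : G.obj m) :
    (f.app n).hom (act G s x) = act G' s ((f.app m).hom x) :=
  congrArg (fun g => g.hom x) (f.naturality s)

/-- The elements of `G_m` that are annihilated by all monomials in `P`. -/
def killed (P : Set (Var N →₀ ℕ)) (G : GrMod 𝕜 N) (m : MDeg N) : Submodule 𝕜 (G.obj m) where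
  carrier := {x | ∀ (n : MDeg N) (s : m ⟶ n), s.1 ∈ P → act G s x = 0}
  zero_mem' _ _ _ := map_zero _
  add_mem' hx hy n s hs := by rw [map_add, hx n s hs, hy n s hs, add_zero]
  smul_mem' c x hx n s hs := by rw [map_smul, hx n s hs, smul_zero]

theorem app_mem_killed {P : Set (Var N →₀ ℕ)} {G G' : GrMod 𝕜 N} (f : G ⟶ G') {m : MDeg N}
    {x : G.obj m} (hx : x ∈ killed P G m) : (f.app m).hom x ∈ killed P G' m := fun n s hs => by
  rw [← app_act, hx n s hs, map_zero]

theorem killed_anti {P Q : Set (Var N →₀ ℕ)} (h : P ⊆ Q) (G : GrMod 𝕜 N) (m : MDeg N) :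
    killed Q G m ≤ killed P G m := fun _ hx n s hs => hx n s (h hs)

/-- The cyclic graded module `S(-m) / (P)`, where `(P)` is the monomial ideal with set of
exponents `P`. -/
noncomputable def cyc (m : MDeg N) (P : UpperSet (Var N →₀ ℕ)) : GrMod 𝕜 N where
  obj n := ModuleCat.of 𝕜
    (((m ⟶ n) →₀ 𝕜) ⧸ Finsupp.supported 𝕜 𝕜 {s : m ⟶ n | s.1 ∈ P})
  map {n p} t := ModuleCat.ofHom <| Submodule.mapQ _ _ (Finsupp.lmapDomain 𝕜 𝕜 fun s => s ≫ t) <| by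
    classical
    intro f hf
    rw [Submodule.mem_comap, Finsupp.mem_supported]
    intro r hr
    obtain ⟨s, hs, rfl⟩ := Finset.mem_image.1 (Finsupp.mapDomain_support hr)
    exact P.upper (le_self_add : s.1 ≤ s.1 + t.1) ((Finsupp.mem_supported _ _).1 hf hs)
  map_id n := by
    ext x
    simp [Finsupp.lmapDomain_apply]
  map_comp s t := by
    ext x
    simp [Finsupp.lmapDomain_apply]

/-- The class in `S(-m) / (P)` of a linear combination of monomials. -/
noncomputable def cycMk (m : MDeg N) (P : UpperSet (Var N →₀ ℕ)) (n : MDeg N) :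
    ((m ⟶ n) →₀ 𝕜) →ₗ[𝕜] (cyc (𝕜 := 𝕜) m P).obj n :=
  Submodule.mkQ (Finsupp.supported 𝕜 𝕜 {s : m ⟶ n | s.1 ∈ P})

theorem cycMk_surjective (m : MDeg N) (P : UpperSet (Var N →₀ ℕ)) (n : MDeg N) :
    Function.Surjective (cycMk (𝕜 := 𝕜) m P n) :=
  Submodule.mkQ_surjective _

theorem cycMk_eq_zero {m : MDeg N} {P : UpperSet (Var N →₀ ℕ)} {n : MDeg N}
    {f : (m ⟶ n) →₀ 𝕜} : cycMk m P n f = 0 ↔ ∀ s ∈ f.support, s.1 ∈ P :=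
  Submodule.Quotient.mk_eq_zero _

theorem act_cycMk_single {m n p : MDeg N} {P : UpperSet (Var N →₀ ℕ)} (t : n ⟶ p) (s : m ⟶ n)
    (c : 𝕜) : act (cyc m P) t (cycMk m P n (Finsupp.single s c)) =
      cycMk m P p (Finsupp.single (s ≫ t) c) := by
  rw [← Finsupp.mapDomain_single (f := fun s : m ⟶ n => s ≫ t)]
  rfl

/-- The homomorphism `S(-m) / (P) ⟶ G` sending the generator to an element `x` that is
annihilated by `P`. -/
noncomputable def cycDesc {m : MDeg N} {P : UpperSet (Var N →₀ ℕ)} {G : GrMod 𝕜 N} (x : G.obj m)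
    (hx : x ∈ killed (P : Set (Var N →₀ ℕ)) G m) : cyc (𝕜 := 𝕜) m P ⟶ G where
  app n := ModuleCat.ofHom <|
    Submodule.liftQ _ (Finsupp.linearCombination 𝕜 fun s : m ⟶ n => act G s x) <| by
      intro f hf
      rw [LinearMap.mem_ker, Finsupp.linearCombination_apply]
      refine Finset.sum_eq_zero fun s hs => ?_
      have h := hx n s ((Finsupp.mem_supported _ _).1 hf hs)
      simp only [h, smul_zero]
  naturality n p t := by
    refine ModuleCat.hom_ext (Submodule.linearMap_qext _ (Finsupp.lhom_ext fun s c => ?_))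
    have h : Finsupp.linearCombination 𝕜 (fun s : m ⟶ p => act G s x)
        (Finsupp.mapDomain (fun s : m ⟶ n => s ≫ t) (Finsupp.single s c)) =
        act G t (Finsupp.linearCombination 𝕜 (fun s : m ⟶ n => act G s x)
          (Finsupp.single s c)) := by
      rw [Finsupp.mapDomain_single, Finsupp.linearCombination_single,
        Finsupp.linearCombination_single, act_comp, map_smul]
    exact h

theorem cycDesc_mk {m : MDeg N} {P : UpperSet (Var N →₀ ℕ)} {G : GrMod 𝕜 N} (x : G.obj m)
    (hx : x ∈ killed (P : Set (Var N →₀ ℕ)) G m) {n : MDeg N} (f : (m ⟶ n) →₀ 𝕜) :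
    ((cycDesc x hx).app n).hom (cycMk m P n f) =
      Finsupp.linearCombination 𝕜 (fun s : m ⟶ n => act G s x) f := rfl

theorem cycDesc_single {m p : MDeg N} {P Q : UpperSet (Var N →₀ ℕ)} (s : m ⟶ p)
    (h : cycMk m P p (Finsupp.single s (1 : 𝕜)) ∈ killed (Q : Set (Var N →₀ ℕ)) (cyc m P) p)
    {n : MDeg N} (f : (p ⟶ n) →₀ 𝕜) :
    ((cycDesc _ h).app n).hom (cycMk p Q n f) =
      cycMk m P n (Finsupp.mapDomain (fun t : p ⟶ n => s ≫ t) f) := by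
  refine (cycDesc_mk _ h f).trans (LinearMap.congr_fun
    (f := Finsupp.linearCombination 𝕜 _)
    (g := cycMk m P n ∘ₗ Finsupp.lmapDomain 𝕜 𝕜 fun t : p ⟶ n => s ≫ t)
    (Finsupp.lhom_ext fun t c => ?_) f)
  rw [Finsupp.linearCombination_single, act_cycMk_single, LinearMap.comp_apply,
    Finsupp.lmapDomain_apply, Finsupp.mapDomain_single, ← map_smul, Finsupp.smul_single,
    smul_eq_mul, mul_one]

/-- The generator of the cyclic module. -/
noncomputable def cycGen (m : MDeg N) (P : UpperSet (Var N →₀ ℕ)) : (cyc (𝕜 := 𝕜) m P).obj m :=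
  cycMk m P m (Finsupp.single (𝟙 m) 1)

theorem cycGen_mem_killed (m : MDeg N) (P : UpperSet (Var N →₀ ℕ)) :
    cycGen (𝕜 := 𝕜) m P ∈ killed (P : Set (Var N →₀ ℕ)) (cyc (𝕜 := 𝕜) m P) m := fun n s hs => by
  rw [cycGen, act_cycMk_single, Category.id_comp, cycMk_eq_zero]
  intro t ht
  rwa [Finset.mem_singleton.1 (Finsupp.support_single_subset ht)]

theorem cycDesc_gen {m : MDeg N} {P : UpperSet (Var N →₀ ℕ)} {G : GrMod 𝕜 N} (x : G.obj m)
    (hx : x ∈ killed (P : Set (Var N →₀ ℕ)) G m) :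
    ((cycDesc x hx).app m).hom (cycGen m P) = x := by
  rw [cycGen, cycDesc_mk, Finsupp.linearCombination_single, act_id, one_smul]

theorem mono_of_forall {G G' : GrMod 𝕜 N} (f : G ⟶ G')
    (h : ∀ n (x : G.obj n), (f.app n).hom x = 0 → x = 0) : Mono f := by
  have : ∀ n, Mono (f.app n) := fun n => by
    rw [ModuleCat.mono_iff_injective]
    exact (injective_iff_map_eq_zero (f.app n).hom).2 (h n)
  exact NatTrans.mono_of_mono_app f

/-- Divisibility in injective graded modules: an equation `s • w = z` has a solution `w` that is
annihilated by a monomial ideal `(P)` as soon as `z` is annihilated by `(P) : s`. -/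
theorem exists_act_eq {E : GrMod 𝕜 N} [Injective E] {m p : MDeg N} (s : m ⟶ p)
    (P : UpperSet (Var N →₀ ℕ)) (z : E.obj p) (hz : z ∈ killed {t | s.1 + t ∈ P} E p) :
    ∃ w ∈ killed (P : Set (Var N →₀ ℕ)) E m, act E s w = z := by
  classical
  let Q : UpperSet (Var N →₀ ℕ) := ⟨{t | s.1 + t ∈ P}, fun a b hab ha =>
    P.upper (add_le_add_right hab s.1) ha⟩
  have hs : act (cyc (𝕜 := 𝕜) m P) s (cycGen m P) = cycMk m P p (Finsupp.single s 1) := by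
    rw [cycGen, act_cycMk_single, Category.id_comp]
  have hgen : cycMk m P p (Finsupp.single s (1 : 𝕜)) ∈
      killed (Q : Set (Var N →₀ ℕ)) (cyc (𝕜 := 𝕜) m P) p := fun n t ht => by
    rw [← hs, ← act_comp]
    exact cycGen_mem_killed m P n (s ≫ t) ht
  -- multiplication by `s` embeds `S(-p) / ((P) : s)` in `S(-m) / (P)`
  let ι : cyc (𝕜 := 𝕜) p Q ⟶ cyc m P := cycDesc _ hgen
  have : Mono ι := by
    refine mono_of_forall ι fun n x hx => ?_
    obtain ⟨f, rfl⟩ := cycMk_surjective _ _ _ x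
    have hinj : Function.Injective fun t : p ⟶ n => s ≫ t := fun a b hab =>
      Subtype.ext (add_left_cancel (congrArg Subtype.val hab : s.1 + a.1 = s.1 + b.1))
    rw [cycDesc_single, cycMk_eq_zero, Finsupp.mapDomain_support_of_injective hinj] at hx
    exact cycMk_eq_zero.2 fun t ht => hx _ (Finset.mem_image_of_mem _ ht)
  let g : cyc m P ⟶ E := Injective.factorThru (cycDesc (P := Q) z hz) ι
  refine ⟨(g.app m).hom (cycGen m P), app_mem_killed g (cycGen_mem_killed m P), ?_⟩
  have h := congrArg (fun q => (q.app p).hom (cycGen p Q))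
    (Injective.comp_factorThru (cycDesc (P := Q) z hz) ι)
  simp only [NatTrans.comp_app, ModuleCat.hom_comp, LinearMap.comp_apply] at h
  rw [cycDesc_gen, cycDesc_gen] at h
  rw [← app_act, hs]
  exact h

/-- Splitting in injective graded modules: an element annihilated by the intersection of two
monomial ideals is a sum of elements annihilated by each of them. -/
theorem exists_add_eq {E : GrMod 𝕜 N} [Injective E] {m : MDeg N} (P Q : UpperSet (Var N →₀ ℕ))
    (z : E.obj m) (hz : z ∈ killed ((P : Set (Var N →₀ ℕ)) ∩ Q) E m) :
    ∃ a ∈ killed (P : Set (Var N →₀ ℕ)) E m, ∃ b ∈ killed (Q : Set (Var N →₀ ℕ)) E m,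
      a + b = z := by
  have hz' : z ∈ killed ((P ⊔ Q : UpperSet (Var N →₀ ℕ)) : Set (Var N →₀ ℕ)) E m := by
    rwa [UpperSet.coe_sup]
  have h₁ : cycGen (𝕜 := 𝕜) m P ∈ killed ((P ⊔ Q : UpperSet (Var N →₀ ℕ)) : Set (Var N →₀ ℕ)) _ m :=
    killed_anti (by rw [UpperSet.coe_sup]; exact Set.inter_subset_left) _ _ (cycGen_mem_killed m P)
  have h₂ : cycGen (𝕜 := 𝕜) m Q ∈ killed ((P ⊔ Q : UpperSet (Var N →₀ ℕ)) : Set (Var N →₀ ℕ)) _ m :=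
    killed_anti (by rw [UpperSet.coe_sup]; exact Set.inter_subset_right) _ _ (cycGen_mem_killed m Q)
  have key : ∀ (R : UpperSet (Var N →₀ ℕ))
      (h : cycGen (𝕜 := 𝕜) m R ∈ killed ((P ⊔ Q : UpperSet (Var N →₀ ℕ)) : Set (Var N →₀ ℕ)) _ m)
      (n : MDeg N) (f : (m ⟶ n) →₀ 𝕜), ((cycDesc _ h).app n).hom (cycMk m (P ⊔ Q) n f) =
        cycMk m R n f := fun R h n f => by
    refine (cycDesc_single (𝟙 m) h f).trans ?_
    simp only [Category.id_comp]
    exact congrArg _ Finsupp.mapDomain_id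
  let q : cyc m (P ⊔ Q) ⟶ cyc m P := cycDesc _ h₁
  let r : cyc m (P ⊔ Q) ⟶ cyc m Q := cycDesc _ h₂
  -- `S / ((P) ∩ (Q))` embeds in `S / (P) ⊕ S / (Q)`
  let ι : cyc (𝕜 := 𝕜) m (P ⊔ Q) ⟶ cyc m P ⊞ cyc m Q := Limits.biprod.lift q r
  have : Mono ι := by
    refine mono_of_forall ι fun n x hx => ?_
    have e₁ : (q.app n).hom x = 0 := by
      rw [← Limits.biprod.lift_fst q r, NatTrans.comp_app, ModuleCat.hom_comp,
        LinearMap.comp_apply]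
      exact (congrArg _ hx).trans (map_zero _)
    have e₂ : (r.app n).hom x = 0 := by
      rw [← Limits.biprod.lift_snd q r, NatTrans.comp_app, ModuleCat.hom_comp,
        LinearMap.comp_apply]
      exact (congrArg _ hx).trans (map_zero _)
    obtain ⟨f, rfl⟩ := cycMk_surjective _ _ _ x
    rw [key, cycMk_eq_zero] at e₁ e₂
    exact cycMk_eq_zero.2 fun t ht => UpperSet.mem_sup_iff.2 ⟨e₁ t ht, e₂ t ht⟩
  let g : cyc m P ⊞ cyc m Q ⟶ E := Injective.factorThru (cycDesc z hz') ι
  refine ⟨_, app_mem_killed (Limits.biprod.inl ≫ g) (cycGen_mem_killed m P),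
    _, app_mem_killed (Limits.biprod.inr ≫ g) (cycGen_mem_killed m Q), ?_⟩
  have h : q ≫ Limits.biprod.inl ≫ g + r ≫ Limits.biprod.inr ≫ g = cycDesc z hz' := by
    rw [← Injective.comp_factorThru (cycDesc z hz') ι, ← Category.assoc, ← Category.assoc,
      ← Preadditive.add_comp]
    congr 1
    exact Limits.biprod.lift_eq.symm
  have h' := congrArg (fun q => (q.app m).hom (cycGen m (P ⊔ Q))) h
  rw [NatTrans.app_add, ModuleCat.hom_add, LinearMap.add_apply, cycDesc_gen, NatTrans.comp_app q,
    NatTrans.comp_app r, ModuleCat.hom_comp, ModuleCat.hom_comp, LinearMap.comp_apply,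
    LinearMap.comp_apply, cycDesc_gen, cycDesc_gen] at h'
  exact h'

/-! ### Torsion with respect to a decreasing sequence of monomial ideals -/

/-- The elements of `G_m` that are annihilated by a member of a decreasing sequence of monomial
ideals. The order on `UpperSet` is reverse inclusion, so that monotone maps are decreasing
sequences. -/
def torsBy (𝔞 : ℕ →o UpperSet (Var N →₀ ℕ)) (G : GrMod 𝕜 N) (m : MDeg N) :
    Submodule 𝕜 (G.obj m) where
  carrier := {x | ∃ t, x ∈ killed (𝔞 t : Set (Var N →₀ ℕ)) G m}
  zero_mem' := ⟨0, zero_mem _⟩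
  add_mem' := by
    rintro x y ⟨a, ha⟩ ⟨b, hb⟩
    exact ⟨a + b, add_mem (killed_anti (𝔞.monotone (Nat.le_add_right a b)) G m ha)
      (killed_anti (𝔞.monotone (Nat.le_add_left b a)) G m hb)⟩
  smul_mem' := fun c _ ⟨a, ha⟩ => ⟨a, Submodule.smul_mem _ c ha⟩

theorem app_mem_torsBy {𝔞 : ℕ →o UpperSet (Var N →₀ ℕ)} {G G' : GrMod 𝕜 N} (f : G ⟶ G')
    {m : MDeg N} {x : G.obj m} (hx : x ∈ torsBy 𝔞 G m) :
    (f.app m).hom x ∈ torsBy 𝔞 G' m :=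
  hx.imp fun _ h => app_mem_killed f h

theorem act_mem_torsBy {𝔞 : ℕ →o UpperSet (Var N →₀ ℕ)} {G : GrMod 𝕜 N} {m p : MDeg N}
    (f : m ⟶ p) {x : G.obj m} (hx : x ∈ torsBy 𝔞 G m) : act G f x ∈ torsBy 𝔞 G p := by
  obtain ⟨t, ht⟩ := hx
  refine ⟨t, fun n s hs => ?_⟩
  rw [← act_comp]
  exact ht n (f ≫ s) ((𝔞 t).upper (le_add_self : s.1 ≤ f.1 + s.1) hs)

/-- The degree of a monomial in the variables belonging to `A`. -/
def degOn (A : Finset (Var N)) (s : Var N →₀ ℕ) : ℕ := ∑ v ∈ A, s v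

theorem degOn_add (A : Finset (Var N)) (s t : Var N →₀ ℕ) :
    degOn A (s + t) = degOn A s + degOn A t := by
  simp [degOn, Finset.sum_add_distrib]

theorem degOn_mono (A : Finset (Var N)) {s t : Var N →₀ ℕ} (h : s ≤ t) :
    degOn A s ≤ degOn A t :=
  Finset.sum_le_sum fun v _ => h v

theorem degOn_subset {A B : Finset (Var N)} (h : A ⊆ B) (s : Var N →₀ ℕ) :
    degOn A s ≤ degOn B s :=
  Finset.sum_le_sum_of_subset h

theorem degOn_union_le (A B : Finset (Var N)) (s : Var N →₀ ℕ) :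
    degOn (A ∪ B) s ≤ degOn A s + degOn B s := by
  have := Finset.sum_union_inter (s₁ := A) (s₂ := B) (f := fun v => s v)
  simp only [degOn]
  lia

theorem degOn_insert {A : Finset (Var N)} {v : Var N} (h : v ∉ A) (s : Var N →₀ ℕ) :
    degOn (insert v A) s = s v + degOn A s :=
  Finset.sum_insert h

theorem degOn_single_le (A : Finset (Var N)) (v : Var N) (t : ℕ) :
    degOn A (Finsupp.single v t) ≤ t := by
  simp only [degOn, Finsupp.single_apply, Finset.sum_ite_eq]
  split_ifs <;> simp

/-- The ideals `⋂_{A ∈ L} 𝔪_A ^ t`, where `𝔪_A` is generated by the variables in `A`. The torsion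
with respect to this sequence is the torsion with respect to the ideal `⋂_{A ∈ L} 𝔪_A`. -/
def powFilt (L : List (Finset (Var N))) : ℕ →o UpperSet (Var N →₀ ℕ) where
  toFun t := ⟨{s | ∀ A ∈ L, t ≤ degOn A s}, fun _ _ h hs A hA => (hs A hA).trans (degOn_mono A h)⟩
  monotone' _ _ h _ hs A hA := h.trans (hs A hA)

theorem mem_powFilt {L : List (Finset (Var N))} {t : ℕ} {s : Var N →₀ ℕ} :
    s ∈ powFilt L t ↔ ∀ A ∈ L, t ≤ degOn A s := Iff.rfl

/-- The ideals `𝔪_A ^ t + 𝔪_B`. An element is torsion with respect to this sequence if it is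
`𝔪_A`-torsion and annihilated by the variables in `B`. -/
def annFilt (A B : Finset (Var N)) : ℕ →o UpperSet (Var N →₀ ℕ) where
  toFun t := ⟨{s | t ≤ degOn A s ∨ ∃ v ∈ B, s v ≠ 0}, fun _ _ h hs => hs.imp
    (fun h' => h'.trans (degOn_mono A h))
    fun ⟨v, hv, h'⟩ => ⟨v, hv, fun h₀ => h' (Nat.le_zero.1 ((h v).trans h₀.le))⟩⟩
  monotone' _ _ h _ hs := hs.imp_left h.trans

theorem mem_annFilt {A B : Finset (Var N)} {t : ℕ} {s : Var N →₀ ℕ} :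
    s ∈ annFilt A B t ↔ t ≤ degOn A s ∨ ∃ v ∈ B, s v ≠ 0 := Iff.rfl

theorem torsBy_annFilt_empty (A : Finset (Var N)) (G : GrMod 𝕜 N) (m : MDeg N) :
    torsBy (annFilt A ∅) G m = torsBy (powFilt [A]) G m := by
  have : annFilt A ∅ = powFilt [A] := by
    ext t s
    simp [mem_annFilt, mem_powFilt]
  rw [this]

/-- On elements annihilated by the variables outside `A`, torsion with respect to all variables is
the same as torsion with respect to the variables in `A`. -/
theorem torsBy_annFilt_compl (A : Finset (Var N)) (G : GrMod 𝕜 N) (m : MDeg N) :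
    torsBy (annFilt Finset.univ Aᶜ) G m = torsBy (annFilt A Aᶜ) G m := by
  have : annFilt Finset.univ Aᶜ = annFilt A Aᶜ := by
    ext t s
    simp only [SetLike.mem_coe, mem_annFilt]
    refine ⟨fun h => ?_, fun h => h.imp_left fun h => h.trans (degOn_subset A.subset_univ s)⟩
    by_cases h' : ∃ v ∈ Aᶜ, s v ≠ 0
    · exact Or.inr h'
    · push Not at h'
      refine h.imp_left fun h => h.trans (le_of_eq ?_)
      exact (Finset.sum_subset A.subset_univ fun v _ hv => h' v (Finset.mem_compl.2 hv)).symm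
  rw [this]

theorem exists_add_of_le {v : Var N} {t : ℕ} {s : Var N →₀ ℕ} (h : t ≤ s v) :
    ∃ s', s = Finsupp.single v t + s' :=
  ⟨s - Finsupp.single v t, (add_tsub_cancel_of_le (Finsupp.single_le_iff.2 h)).symm⟩

theorem monDeg_single (v : Var N) (t : ℕ) :
    monDeg N (Finsupp.single v t) = t • varDeg N v := by
  simp [monDeg, Finsupp.weight_apply]

/-- Multiplication by a power of a variable. -/
noncomputable def varHom (m : MDeg N) (v : Var N) (t : ℕ) : m ⟶ (⟨m.deg + t • varDeg N v⟩ : MDeg N) :=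
  ⟨Finsupp.single v t, by rw [monDeg_single]⟩

/-- Multiplication by a variable, with prescribed target. -/
noncomputable def varHomTo (m : MDeg N) (v : Var N) : (⟨m.deg - varDeg N v⟩ : MDeg N) ⟶ m :=
  ⟨Finsupp.single v 1, by rw [monDeg_single, one_smul, sub_add_cancel]⟩

/-- A monomial divisible by the exponent of `f` acts through `act f`. -/
theorem act_eq_zero_of_act_eq_zero {G : GrMod 𝕜 N} {m p n : MDeg N} (f : m ⟶ p) (s : m ⟶ n)
    {r : Var N →₀ ℕ} (hr : s.1 = f.1 + r) {x : G.obj m} (hx : act G f x = 0) : act G s x = 0 := by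
  have hr' : p.deg + monDeg N r = n.deg := by
    rw [← s.2, hr, map_add, ← add_assoc, f.2]
  have : s = f ≫ (⟨r, hr'⟩ : p ⟶ n) := Subtype.ext hr
  rw [this, act_comp, hx, map_zero]

theorem mem_torsBy_insert_left {A : Finset (Var N)} {v : Var N} (G : GrMod 𝕜 N) (m : MDeg N)
    (x : G.obj m) : x ∈ torsBy (annFilt (insert v A) ∅) G m ↔
      x ∈ torsBy (annFilt A ∅) G m ∧ ∃ t : ℕ, act G (varHom m v t) x = 0 := by
  by_cases hv : v ∈ A
  · rw [Finset.insert_eq_of_mem hv]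
    refine ⟨fun h => ⟨h, ?_⟩, And.left⟩
    obtain ⟨t, ht⟩ := h
    refine ⟨t, ht _ _ (Or.inl ?_)⟩
    simp [degOn, varHom, Finsupp.single_apply, hv]
  constructor
  · rintro ⟨t, ht⟩
    refine ⟨⟨t, fun n s hs => ht n s (hs.imp_left fun h =>
      h.trans (degOn_subset (Finset.subset_insert v A) _))⟩, t, ht _ _ (Or.inl ?_)⟩
    · simp [degOn_insert hv, varHom]
  · rintro ⟨⟨a, ha⟩, t, ht⟩
    refine ⟨a + t, fun n s hs => ?_⟩
    rcases hs with hs | ⟨w, hw, -⟩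
    · rw [degOn_insert hv] at hs
      by_cases h : a ≤ degOn A s.1
      · exact ha n s (Or.inl h)
      · obtain ⟨r, hr⟩ := exists_add_of_le (v := v) (t := t) (s := s.1) (by lia)
        exact act_eq_zero_of_act_eq_zero (varHom m v t) s hr ht
    · exact absurd hw (Finset.notMem_empty w)

theorem mem_torsBy_insert_right {A B : Finset (Var N)} {v : Var N} (G : GrMod 𝕜 N) (m : MDeg N)
    (x : G.obj m) : x ∈ torsBy (annFilt A (insert v B)) G m ↔
      x ∈ torsBy (annFilt A B) G m ∧ act G (varHom m v 1) x = 0 := by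
  constructor
  · rintro ⟨t, ht⟩
    refine ⟨⟨t, fun n s hs => ht n s (hs.imp_right ?_)⟩, ht _ _ (Or.inr ⟨v, by simp, ?_⟩)⟩
    · rintro ⟨w, hw, h⟩
      exact ⟨w, Finset.mem_insert_of_mem hw, h⟩
    · simp [varHom]
  · rintro ⟨⟨a, ha⟩, hx⟩
    refine ⟨a, fun n s hs => ?_⟩
    rcases hs with hs | ⟨w, hw, h⟩
    · exact ha n s (Or.inl hs)
    · rcases Finset.mem_insert.1 hw with rfl | hw
      · obtain ⟨r, hr⟩ := exists_add_of_le (v := w) (t := 1) (s := s.1) (by lia)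
        exact act_eq_zero_of_act_eq_zero (varHom m w 1) s hr hx
      · exact ha n s (Or.inr ⟨w, hw, h⟩)

/-- In an injective module, the `𝔪_A`-torsion elements that are annihilated by the variables in `B`
are divisible by the powers of every variable outside `B`. -/
theorem exists_act_eq_torsBy {E : GrMod 𝕜 N} [Injective E] {A B : Finset (Var N)} {v : Var N}
    (hv : v ∉ B) {m p : MDeg N} (f : m ⟶ p) {t : ℕ} (hf : f.1 = Finsupp.single v t)
    {z : E.obj p} (hz : z ∈ torsBy (annFilt A B) E p) :
    ∃ w ∈ torsBy (annFilt A B) E m, act E f w = z := by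
  obtain ⟨a, ha⟩ := hz
  have h : {s | f.1 + s ∈ annFilt A B (a + t)} ⊆ (annFilt A B a : Set (Var N →₀ ℕ)) := by
    rintro s (hs | ⟨w, hw, h⟩)
    · rw [hf, degOn_add] at hs
      have := degOn_single_le A v t
      exact Or.inl (by lia)
    · refine Or.inr ⟨w, hw, ?_⟩
      rwa [hf, Finsupp.add_apply, Finsupp.single_eq_of_ne (by rintro rfl; exact hv hw),
        zero_add] at h
  obtain ⟨w, hw, rfl⟩ := exists_act_eq f (annFilt A B (a + t)) z (killed_anti h E p ha)
  exact ⟨w, ⟨_, hw⟩, rfl⟩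

/-! ### Complexes of injective graded modules -/

/-- A cochain complex of injective graded modules `0 = E_0 → E_1 → E_2 → ⋯`. Starting with a zero
object spares a case distinction at the beginning of the complex. -/
structure InjComplex (𝕜 : Type u) [Field 𝕜] {k : ℕ} (N : Fin k → ℕ) where
  /-- the terms of the complex -/
  E : ℕ → GrMod 𝕜 N
  /-- the differentials -/
  d : ∀ i, E i ⟶ E (i + 1)
  d_comp_d : ∀ i, d i ≫ d (i + 1) = 0
  injective : ∀ i, Injective (E i)
  eq_zero : ∀ (m : MDeg N) (x : (E 0).obj m), x = 0

namespace InjComplex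

variable (X : InjComplex 𝕜 N)

instance (i : ℕ) : Injective (X.E i) := X.injective i

/-- The differential in a given multidegree. -/
def δ (i : ℕ) (m : MDeg N) : (X.E i).obj m →ₗ[𝕜] (X.E (i + 1)).obj m := ((X.d i).app m).hom

theorem δ_δ (i : ℕ) (m : MDeg N) (x : (X.E i).obj m) : X.δ (i + 1) m (X.δ i m x) = 0 :=
  congrArg (fun f => (f.app m).hom x) (X.d_comp_d i)

theorem δ_act (i : ℕ) {m p : MDeg N} (f : m ⟶ p) (x : (X.E i).obj m) :
    X.δ i p (act _ f x) = act _ f (X.δ i m x) :=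
  app_act (X.d i) f x

theorem δ_mem_torsBy {𝔞 : ℕ →o UpperSet (Var N →₀ ℕ)} {i : ℕ} {m : MDeg N} {x : (X.E i).obj m}
    (hx : x ∈ torsBy 𝔞 (X.E i) m) : X.δ i m x ∈ torsBy 𝔞 (X.E (i + 1)) m :=
  app_mem_torsBy (X.d i) hx

/-- The degree-`m` part of the subcomplex of torsion elements has no cohomology. -/
def Acyclic (𝔞 : ℕ →o UpperSet (Var N →₀ ℕ)) (m : MDeg N) : Prop :=
  ∀ (i : ℕ), ∀ z ∈ torsBy 𝔞 (X.E (i + 1)) m, X.δ (i + 1) m z = 0 →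
    ∃ w ∈ torsBy 𝔞 (X.E i) m, X.δ i m w = z

variable {X}

theorem acyclic_congr {𝔞 𝔟 : ℕ →o UpperSet (Var N →₀ ℕ)} {m : MDeg N}
    (h : ∀ G : GrMod 𝕜 N, torsBy 𝔞 G m = torsBy 𝔟 G m) : X.Acyclic 𝔞 m ↔ X.Acyclic 𝔟 m := by
  simp only [Acyclic, h]

/-- The common core of passing to elements annihilated by a variable and to elements annihilated
by a power of it. A cycle `z` in the smaller subcomplex is a boundary `δ w` in the larger one;
multiplying by a power of the variable turns `w` into a cycle, hence into a boundary, and by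
divisibility the latter can be used to correct `w`. -/
theorem exists_δ_eq_of_acyclic {A B : Finset (Var N)} {v : Var N} (hv : v ∉ B) {m : MDeg N} (t : ℕ)
    (h : X.Acyclic (annFilt A B) m) (h' : X.Acyclic (annFilt A B) ⟨m.deg + t • varDeg N v⟩)
    {i : ℕ} {z : (X.E (i + 1)).obj m} (hz : z ∈ torsBy (annFilt A B) (X.E (i + 1)) m)
    (hzt : act _ (varHom m v t) z = 0) (hδ : X.δ (i + 1) m z = 0) :
    ∃ w ∈ torsBy (annFilt A B) (X.E i) m, act _ (varHom m v t) w = 0 ∧ X.δ i m w = z := by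
  obtain ⟨w, hw, rfl⟩ := h i z hz hδ
  cases i with
  | zero => exact ⟨w, hw, by rw [X.eq_zero m w, map_zero], rfl⟩
  | succ i =>
    obtain ⟨u, hu, hwu⟩ := h' i _ (act_mem_torsBy (varHom m v t) hw) (by rw [δ_act, hzt])
    obtain ⟨u', hu', rfl⟩ := exists_act_eq_torsBy hv (varHom m v t) rfl hu
    refine ⟨w - X.δ i m u', sub_mem hw (X.δ_mem_torsBy hu'), ?_, ?_⟩
    · rw [map_sub, ← hwu, δ_act, sub_self]
    · rw [map_sub, δ_δ, sub_zero]

theorem acyclic_insert_right {A B : Finset (Var N)} {v : Var N} (hv : v ∉ B) {m : MDeg N}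
    (h : X.Acyclic (annFilt A B) m) (h' : X.Acyclic (annFilt A B) ⟨m.deg + varDeg N v⟩) :
    X.Acyclic (annFilt A (insert v B)) m := by
  intro i z hz hδ
  rw [mem_torsBy_insert_right] at hz
  obtain ⟨w, hw, hwt, hwz⟩ :=
    exists_δ_eq_of_acyclic hv 1 h (by rwa [one_smul]) hz.1 hz.2 hδ
  exact ⟨w, (mem_torsBy_insert_right _ _ _).2 ⟨hw, hwt⟩, hwz⟩

theorem acyclic_insert_left {A : Finset (Var N)} {v : Var N} {m : MDeg N}
    (h : ∀ t : ℕ, X.Acyclic (annFilt A ∅) ⟨m.deg + t • varDeg N v⟩) :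
    X.Acyclic (annFilt (insert v A) ∅) m := by
  intro i z hz hδ
  rw [mem_torsBy_insert_left] at hz
  obtain ⟨hz, t, hzt⟩ := hz
  have h₀ : X.Acyclic (annFilt A ∅) m := by simpa using h 0
  obtain ⟨w, hw, hwt, hwz⟩ :=
    exists_δ_eq_of_acyclic (Finset.notMem_empty v) t h₀ (h t) hz hzt hδ
  exact ⟨w, (mem_torsBy_insert_left _ _ _).2 ⟨hw, t, hwt⟩, hwz⟩

/-- A graded Nakayama lemma for complexes. If the elements annihilated by the variable `v` form an
acyclic complex in the degrees in `D`, then `v` acts surjectively on the cohomology of the whole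
complex in these degrees; as this cohomology vanishes in low degrees, it vanishes. -/
theorem acyclic_of_insert_right {A B : Finset (Var N)} {v : Var N} (hv : v ∉ B)
    {D : Set (MDeg N)} (hD : ∀ m ∈ D, (⟨m.deg - varDeg N v⟩ : MDeg N) ∈ D)
    (h : ∀ m ∈ D, X.Acyclic (annFilt A (insert v B)) m)
    (φ : (Fin k → ℤ) →+ ℤ) (hφ : φ (varDeg N v) = 1) {c : ℤ}
    (hc : ∀ m : MDeg N, φ m.deg < c → X.Acyclic (annFilt A B) m) {m : MDeg N} (hm : m ∈ D) :
    X.Acyclic (annFilt A B) m := by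
  have key : ∀ (b : ℕ) (m : MDeg N), m ∈ D → φ m.deg < c + b → X.Acyclic (annFilt A B) m := by
    intro b
    induction b with
    | zero => exact fun m _ hm => hc m (by simpa using hm)
    | succ b ih =>
      intro m hm hmb i z hz hδ
      let f := varHomTo m v
      obtain ⟨w, hw, rfl⟩ := exists_act_eq_torsBy hv f rfl hz
      have hf : ∀ {j : ℕ} (x : (X.E j).obj ⟨m.deg - varDeg N v⟩), act (X.E j) f x = 0 →
          act (X.E j) (varHom _ v 1) x = 0 := fun x hx =>
        act_eq_zero_of_act_eq_zero f (varHom _ v 1) (r := 0) (add_zero _).symm hx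
      have hf' : ∀ {j : ℕ} (x : (X.E j).obj ⟨m.deg - varDeg N v⟩),
          act (X.E j) (varHom _ v 1) x = 0 → act (X.E j) f x = 0 := fun x hx =>
        act_eq_zero_of_act_eq_zero (varHom _ v 1) f (r := 0) (add_zero _).symm hx
      rw [δ_act] at hδ
      -- `w` need not be a cycle, but `δ w` is a cycle annihilated by `v`
      obtain ⟨y, hy, hyw⟩ := h _ (hD m hm) (i + 1) (X.δ (i + 1) _ w)
        ((mem_torsBy_insert_right _ _ _).2 ⟨X.δ_mem_torsBy hw, hf _ hδ⟩) (X.δ_δ _ _ _)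
      rw [mem_torsBy_insert_right] at hy
      obtain ⟨q, hq, hqw⟩ := ih _ (hD m hm) (by
        rw [map_sub, hφ]; push_cast at hmb; lia) i (w - y) (sub_mem hw hy.1)
        (by rw [map_sub, hyw, sub_self])
      refine ⟨act _ f q, act_mem_torsBy f hq, ?_⟩
      rw [δ_act, hqw, map_sub, hf' y hy.2, sub_zero]
  exact key (φ m.deg - c + 1).toNat m hm (by lia)

/-- The Mayer–Vietoris argument: the subcomplex of `(𝔪_A ∩ 𝔟)`-torsion elements is acyclic if those
of `𝔪_A`-torsion, `𝔟`-torsion and `(𝔪_A + 𝔟)`-torsion elements are. Here `𝔟 = ⋂_{B ∈ L} 𝔪_B`, and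
`𝔪_A + 𝔟` has the same radical as `⋂_{B ∈ L} 𝔪_{A ∪ B}`. -/
theorem acyclic_cons {A : Finset (Var N)} {L : List (Finset (Var N))} {m : MDeg N}
    (hA : X.Acyclic (powFilt [A]) m) (hL : X.Acyclic (powFilt L) m)
    (hAL : X.Acyclic (powFilt (L.map (A ∪ ·))) m) : X.Acyclic (powFilt (A :: L)) m := by
  have le₁ : ∀ G : GrMod 𝕜 N, torsBy (powFilt [A]) G m ≤ torsBy (powFilt (A :: L)) G m :=
    fun G x ⟨t, ht⟩ => ⟨t, fun n s hs => ht n s (by simpa [mem_powFilt] using hs A (by simp))⟩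
  have le₂ : ∀ G : GrMod 𝕜 N, torsBy (powFilt L) G m ≤ torsBy (powFilt (A :: L)) G m :=
    fun G x ⟨t, ht⟩ => ⟨t, fun n s hs => ht n s fun B hB => hs B (by simp [hB])⟩
  have le₃ : ∀ G : GrMod 𝕜 N, torsBy (powFilt (L.map (A ∪ ·))) G m ≤ torsBy (powFilt [A]) G m :=
    fun G x ⟨t, ht⟩ => ⟨t, fun n s hs => ht n s fun B hB => by
      obtain ⟨B, -, rfl⟩ := List.mem_map.1 hB
      exact (hs A (by simp)).trans (degOn_subset Finset.subset_union_left _)⟩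
  have le₄ : ∀ G : GrMod 𝕜 N, torsBy (powFilt (L.map (A ∪ ·))) G m ≤ torsBy (powFilt L) G m :=
    fun G x ⟨t, ht⟩ => ⟨t, fun n s hs => ht n s fun B hB => by
      obtain ⟨B, hB', rfl⟩ := List.mem_map.1 hB
      exact (hs B hB').trans (degOn_subset Finset.subset_union_right _)⟩
  intro i z ⟨t, ht⟩ hδ
  have hz : z ∈ killed ((powFilt [A] t : Set (Var N →₀ ℕ)) ∩ powFilt L t) (X.E (i + 1)) m :=
    killed_anti (fun s hs B hB => by
      rcases List.mem_cons.1 hB with rfl | hB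
      · exact hs.1 B (by simp)
      · exact hs.2 B hB) _ _ ht
  obtain ⟨a, ha, b, hb, rfl⟩ := exists_add_eq _ _ z hz
  have hab : X.δ (i + 1) m a = -X.δ (i + 1) m b := by
    rw [map_add] at hδ
    exact eq_neg_of_add_eq_zero_left hδ
  -- the differential of `a` is torsion for both ideals, hence for their sum
  have hda : X.δ (i + 1) m a ∈ torsBy (powFilt (L.map (A ∪ ·))) (X.E (i + 2)) m := by
    refine ⟨t + t, fun n s hs => ?_⟩
    by_cases h : t ≤ degOn A s.1
    · exact app_mem_killed (X.d (i + 1)) ha n s (by simpa [mem_powFilt] using h)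
    · have hb' : X.δ (i + 1) m a ∈ killed (powFilt L t : Set (Var N →₀ ℕ)) (X.E (i + 2)) m := by
        rw [hab]
        exact neg_mem (app_mem_killed (X.d (i + 1)) hb)
      refine hb' n s fun B hB => ?_
      have h₁ := hs (A ∪ B) (List.mem_map_of_mem hB)
      have h₂ := degOn_union_le A B s.1
      lia
  obtain ⟨y, hy, hya⟩ := hAL (i + 1) _ hda (X.δ_δ _ _ _)
  obtain ⟨α, hα, hα'⟩ := hA i (a - y) (sub_mem ⟨t, ha⟩ (le₃ _ hy)) (by rw [map_sub, hya, sub_self])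
  obtain ⟨β, hβ, hβ'⟩ := hL i (b + y) (add_mem ⟨t, hb⟩ (le₄ _ hy))
    (by rw [map_add, hya, hab, add_neg_cancel])
  refine ⟨α + β, add_mem (le₁ _ hα) (le₂ _ hβ), ?_⟩
  rw [map_add, hα', hβ']
  abel

end InjComplex

namespace InjComplex

variable {X : InjComplex 𝕜 N}

/-! ### From the ideal of all variables to ideals of some variables and their intersections -/

/-- If the cohomology of the whole complex is bounded below with respect to a weight `φ`, so are
the cohomologies of the subcomplexes of torsion elements with respect to variables of weight `0`. -/
theorem acyclic_annFilt_empty_of_lt (φ : (Fin k → ℤ) →+ ℤ) {c : ℤ}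
    (hc : ∀ m : MDeg N, φ m.deg < c → X.Acyclic (annFilt ∅ ∅) m) (A : Finset (Var N))
    (hA : ∀ v ∈ A, φ (varDeg N v) = 0) (m : MDeg N) (hm : φ m.deg < c) :
    X.Acyclic (annFilt A ∅) m := by
  induction A using Finset.induction_on generalizing m with
  | empty => exact hc m hm
  | insert v A _ ih =>
    refine acyclic_insert_left fun t => ih (fun w hw => hA w (Finset.mem_insert_of_mem hw)) _ ?_
    rwa [map_add, map_nsmul, hA v (Finset.mem_insert_self v A), smul_zero, add_zero]

theorem acyclic_annFilt_of_lt (φ : (Fin k → ℤ) →+ ℤ) {c : ℤ} {A : Finset (Var N)}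
    (hc : ∀ m : MDeg N, φ m.deg < c → X.Acyclic (annFilt A ∅) m) (B : Finset (Var N))
    (hB : ∀ v ∈ B, φ (varDeg N v) = 1) (m : MDeg N) (hm : φ m.deg < c - B.card) :
    X.Acyclic (annFilt A B) m := by
  induction B using Finset.induction_on generalizing m with
  | empty => exact hc m (by simpa using hm)
  | insert v B hv ih =>
    rw [Finset.card_insert_of_notMem hv] at hm
    push_cast at hm
    have ih' := ih fun w hw => hB w (Finset.mem_insert_of_mem hw)
    refine acyclic_insert_right hv (ih' m (by lia)) (ih' _ ?_)
    rw [map_add, hB v (Finset.mem_insert_self v B)]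
    lia

/-- If the complex of torsion elements with respect to all variables is acyclic in a set of degrees
`D` that is stable under shifts by the degrees of the variables outside `A`, then so is the complex
of torsion elements with respect to the variables in `A`, provided that the cohomology of the whole
complex is bounded below in the direction of the variables outside `A`. -/
theorem acyclic_of_acyclic_univ {A : Finset (Var N)} (φ : (Fin k → ℤ) →+ ℤ)
    (hφ₀ : ∀ v ∈ A, φ (varDeg N v) = 0) (hφ₁ : ∀ v ∉ A, φ (varDeg N v) = 1) {c : ℤ}
    (hc : ∀ m : MDeg N, φ m.deg < c → X.Acyclic (annFilt ∅ ∅) m) {D : Set (MDeg N)}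
    (hD : ∀ v ∉ A, ∀ m ∈ D, (⟨m.deg + varDeg N v⟩ : MDeg N) ∈ D)
    (hD' : ∀ v ∉ A, ∀ m ∈ D, (⟨m.deg - varDeg N v⟩ : MDeg N) ∈ D)
    (h : ∀ m ∈ D, X.Acyclic (annFilt Finset.univ ∅) m) {m : MDeg N} (hm : m ∈ D) :
    X.Acyclic (annFilt A ∅) m := by
  -- pass to the elements annihilated by the variables outside `A`
  have h₁ : ∀ B ⊆ Aᶜ, ∀ m ∈ D, X.Acyclic (annFilt Finset.univ B) m := by
    intro B
    induction B using Finset.induction_on with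
    | empty => exact fun _ => h
    | insert v B hv ih =>
      intro hB m hm
      have ih' := ih ((Finset.subset_insert v B).trans hB)
      have hvA : v ∉ A := Finset.mem_compl.1 (hB (Finset.mem_insert_self v B))
      exact acyclic_insert_right hv (ih' m hm) (ih' _ (hD v hvA m hm))
  -- remove these variables again, with the variables in `A` only as torsion condition
  have h₂ : ∀ C : Finset (Var N), ∀ m ∈ D, X.Acyclic (annFilt A (Aᶜ \ C)) m := by
    intro C
    induction C using Finset.induction_on with
    | empty =>
      intro m hm
      rw [Finset.sdiff_empty, ← acyclic_congr fun G => torsBy_annFilt_compl A G m]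
      exact h₁ _ subset_rfl m hm
    | insert v C hv ih =>
      intro m hm
      by_cases hvA : v ∈ A
      · have : Aᶜ \ insert v C = Aᶜ \ C := by
          ext w
          simp only [Finset.mem_sdiff, Finset.mem_compl, Finset.mem_insert, not_or]
          exact ⟨fun h => ⟨h.1, h.2.2⟩, fun h => ⟨h.1, fun hw => h.1 (hw ▸ hvA), h.2⟩⟩
        rw [this]
        exact ih m hm
      · have hins : insert v (Aᶜ \ insert v C) = Aᶜ \ C := by
          ext w
          simp only [Finset.mem_sdiff, Finset.mem_compl, Finset.mem_insert, not_or]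
          by_cases hw : w = v
          · subst hw
            simp [hvA, hv]
          · simp [hw]
        refine acyclic_of_insert_right (v := v) (by simp) (hD' v hvA)
          (fun m hm => by rw [hins]; exact ih m hm) φ (hφ₁ v hvA)
          (acyclic_annFilt_of_lt φ (acyclic_annFilt_empty_of_lt φ hc A hφ₀) _ fun w hw =>
            hφ₁ w ?_) hm
        exact Finset.mem_compl.1 (Finset.mem_sdiff.1 hw).1
  simpa using h₂ Aᶜ m hm

/-- Acyclicity for the ideals `𝔪_A`, with `A` in a family of sets that is closed under unions,
extends to the intersections of these ideals. -/
theorem acyclic_powFilt_of_forall {S : Set (Finset (Var N))}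
    (hS : ∀ A ∈ S, ∀ B ∈ S, A ∪ B ∈ S) {m : MDeg N}
    (h : ∀ A ∈ S, X.Acyclic (powFilt [A]) m) (L : List (Finset (Var N))) (hL : ∀ A ∈ L, A ∈ S) :
    X.Acyclic (powFilt L) m := by
  induction hn : L.length generalizing L with
  | zero =>
    obtain rfl := List.length_eq_zero_iff.1 hn
    -- only the zero element is annihilated by the unit ideal
    rintro i z ⟨t, ht⟩ -
    refine ⟨0, zero_mem _, ?_⟩
    rw [map_zero, ← act_id _ z]
    exact (ht m (𝟙 m) (by simp [mem_powFilt])).symm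
  | succ n ih =>
    cases L with
    | nil => simp at hn
    | cons A L =>
      have hn' : L.length = n := by simpa using hn
      have hA := hL A (by simp)
      have hL' : ∀ B ∈ L, B ∈ S := fun B hB => hL B (by simp [hB])
      refine acyclic_cons (h A hA) (ih L hL' hn') (ih _ (fun B hB => ?_) (by simpa using hn'))
      obtain ⟨C, hC, rfl⟩ := List.mem_map.1 hB
      exact hS A hA C (hL' C hC)

end InjComplex

/-! ### Torsion with respect to ideals generated by variables -/

/-- The ideal generated by the variables in `A`. -/
noncomputable def varIdeal (𝕜 : Type u) [Field 𝕜] (A : Finset (Var N)) : Ideal (PolyRing 𝕜 N) :=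
  Ideal.span (MvPolynomial.X '' (A : Set (Var N)))

theorem mem_varIdeal {A : Finset (Var N)} {p : PolyRing 𝕜 N} :
    p ∈ varIdeal 𝕜 A ↔ ∀ s ∈ p.support, 1 ≤ degOn A s := by
  rw [varIdeal, MvPolynomial.mem_ideal_span_X_image]
  refine forall₂_congr fun s _ => ?_
  simp [degOn, Nat.one_le_iff_ne_zero, Finset.sum_eq_zero_iff]

theorem le_degOn_of_mem_pow {A : Finset (Var N)} {t : ℕ} {p : PolyRing 𝕜 N}
    (hp : p ∈ varIdeal 𝕜 A ^ t) : ∀ s ∈ p.support, t ≤ degOn A s := by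
  classical
  induction t generalizing p with
  | zero => exact fun _ _ => Nat.zero_le _
  | succ t ih =>
    rw [pow_succ] at hp
    induction hp using Submodule.mul_induction_on' with
    | mem_mul_mem a ha b hb =>
      intro s hs
      obtain ⟨x, hx, y, hy, rfl⟩ := Finset.mem_add.1 (MvPolynomial.support_mul a b hs)
      rw [degOn_add]
      exact add_le_add (ih ha x hx) (mem_varIdeal.1 hb y hy)
    | add a _ b _ ha hb =>
      intro s hs
      rcases Finset.mem_union.1 (MvPolynomial.support_add hs) with hs | hs
      · exact ha s hs
      · exact hb s hs

/-- The exponent `card · t + 1` suffices: by the pigeonhole principle, the variables whose exponent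
in the monomial is at least `t` meet every `A ∈ L`, so that their product lies in the ideal, and
its `t`-th power divides the monomial. -/
theorem monomial_mem_pow {L : List (Finset (Var N))} {t : ℕ} {s : Var N →₀ ℕ}
    (hs : ∀ A ∈ L, Fintype.card (Var N) * t + 1 ≤ degOn A s) :
    (MvPolynomial.monomial s 1 : PolyRing 𝕜 N) ∈ (⨅ A ∈ L, varIdeal 𝕜 A) ^ t := by
  classical
  let b : Var N →₀ ℕ := Finsupp.equivFunOnFinite.symm fun v => if t ≤ s v then 1 else 0
  have hb : t • b ≤ s := fun v => by
    simp only [b, Finsupp.smul_apply, Finsupp.equivFunOnFinite_symm_apply_apply, smul_eq_mul]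
    split_ifs with h <;> simp [h]
  have hmem : (MvPolynomial.monomial b 1 : PolyRing 𝕜 N) ∈ ⨅ A ∈ L, varIdeal 𝕜 A := by
    simp only [Submodule.mem_iInf]
    intro A hA
    rw [mem_varIdeal]
    intro r hr
    rw [Finset.mem_singleton.1 (MvPolynomial.support_monomial_subset hr)]
    by_contra hlt
    have hzero : ∀ v ∈ A, b v = 0 := by
      refine Finset.sum_eq_zero_iff.1 (?_ : degOn A b = 0)
      lia
    have hle : degOn A s ≤ A.card * t := by
      refine (Finset.sum_le_card_nsmul A _ t fun v hv => ?_).trans_eq (smul_eq_mul _ _)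
      have := hzero v hv
      simp only [b, Finsupp.equivFunOnFinite_symm_apply_apply] at this
      split_ifs at this with h
      exact (not_le.1 h).le
    have := Nat.mul_le_mul_right t A.card_le_univ
    have := hs A hA
    lia
  have : (MvPolynomial.monomial s 1 : PolyRing 𝕜 N) =
      MvPolynomial.monomial (s - t • b) 1 * MvPolynomial.monomial b 1 ^ t := by
    rw [MvPolynomial.monomial_pow, MvPolynomial.monomial_mul, one_pow, mul_one,
      tsub_add_cancel_of_le hb]
  rw [this]
  exact Ideal.mul_mem_left _ _ (Ideal.pow_mem_pow hmem t)

theorem polyAct_monomial_incl (G : GrMod 𝕜 N) {m n : MDeg N} (s : m ⟶ n) (c : 𝕜) (x : G.obj m) :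
    polyAct G (MvPolynomial.monomial s.1 c) (incl G m x) = c • incl G n (act G s x) := by
  rw [polyAct_monomial, LinearMap.smul_apply, monEnd_incl]
  rfl

/-- The torsion with respect to an intersection of ideals generated by variables, in terms of
monomials. -/
theorem torsionPiece_iInf (L : List (Finset (Var N))) (G : GrMod 𝕜 N) (m : MDeg N) :
    torsionPiece (⨅ A ∈ L, varIdeal 𝕜 A) G m = torsBy (powFilt L) G m := by
  ext x
  constructor
  · rintro ⟨t, ht⟩
    refine ⟨Fintype.card (Var N) * t + 1, fun n s hs => ?_⟩
    have h := ht _ (monomial_mem_pow hs)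
    rw [polyAct_monomial_incl, one_smul] at h
    exact DirectSum.of_injective n (h.trans (map_zero _).symm)
  · rintro ⟨t, ht⟩
    refine ⟨t, fun p hp => ?_⟩
    rw [← MvPolynomial.support_sum_monomial_coeff p, map_sum, LinearMap.sum_apply]
    refine Finset.sum_eq_zero fun s hs => ?_
    refine (polyAct_monomial_incl G (monHom N m s) _ x).trans ?_
    rw [ht _ (monHom N m s) fun A hA => ?_, map_zero, smul_zero]
    exact le_degOn_of_mem_pow (Ideal.pow_right_mono (iInf₂_le A hA) t hp) s hs

/-! ### Local cohomology in terms of an injective resolution -/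

open Limits ZeroObject in
/-- An injective resolution, with a zero object added in front. -/
noncomputable def InjComplex.ofResolution {G : GrMod 𝕜 N} (R : InjectiveResolution G) :
    InjComplex 𝕜 N where
  E
    | 0 => 0
    | i + 1 => R.cocomplex.X i
  d
    | 0 => 0
    | i + 1 => R.cocomplex.d i (i + 1)
  d_comp_d
    | 0 => zero_comp
    | _ + 1 => R.cocomplex.d_comp_d _ _ _
  injective
    | 0 => Injective.zero_injective
    | i + 1 => R.injective i
  eq_zero m x :=
    congrArg (fun f => (f.app m).hom x) ((isZero_zero (GrMod 𝕜 N)).eq_of_src (𝟙 _) 0)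

/-- The criterion for the vanishing of a graded piece of a local cohomology module: in the
resolution, every torsion cycle is the boundary of a torsion element. -/
theorem subsingleton_localCoh_iff {G : GrMod 𝕜 N} (R : InjectiveResolution G)
    (U : Ideal (PolyRing 𝕜 N)) (i : ℕ) (m : MDeg N) :
    Subsingleton (((localCoh U i).obj G).obj m) ↔
      ∀ z ∈ torsionPiece U ((InjComplex.ofResolution R).E (i + 1)) m,
        (InjComplex.ofResolution R).δ (i + 1) m z = 0 →
        ∃ w ∈ torsionPiece U ((InjComplex.ofResolution R).E i) m,
          (InjComplex.ofResolution R).δ i m w = z := by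
  let ev : GrMod 𝕜 N ⥤ ModuleCat.{u} 𝕜 := (evaluation (MDeg N) (ModuleCat.{u} 𝕜)).obj m
  let K := ((torsion U).mapHomologicalComplex (ComplexShape.up ℕ)).obj R.cocomplex
  let K' := (ev.mapHomologicalComplex (ComplexShape.up ℕ)).obj K
  have e : ((localCoh U i).obj G).obj m ≅ K'.homology i :=
    ev.mapIso (R.isoRightDerivedObj (torsion U) i) ≪≫ ((K.sc i).mapHomologyIso ev).symm
  rw [← ModuleCat.isZero_iff_subsingleton, e.isZero_iff, ← K'.exactAt_iff_isZero_homology]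
  cases i with
  | zero =>
    rw [K'.exactAt_iff' 0 0 1 (by simp) (by simp), ShortComplex.moduleCat_exact_iff]
    constructor
    · intro h z hz hδ
      obtain ⟨w, hw⟩ := h ⟨z, hz⟩ (Subtype.ext hδ)
      refine ⟨0, zero_mem _, ?_⟩
      rw [map_zero]
      have h₀ : K'.d 0 0 = 0 := K'.shape 0 0 (by simp)
      have hw' : (K'.d 0 0).hom w = ⟨z, hz⟩ := hw
      rw [h₀] at hw'
      exact congrArg Subtype.val hw'
    · rintro h ⟨z, hz⟩ hδ
      obtain ⟨w, -, hw⟩ := h z hz (congrArg Subtype.val hδ)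
      refine ⟨0, ?_⟩
      rw [map_zero]
      refine Subtype.ext (Eq.trans ?_ hw)
      rw [(InjComplex.ofResolution R).eq_zero m w, map_zero]
      rfl
  | succ i =>
    rw [K'.exactAt_iff' i (i + 1) (i + 2) (by simp) (by simp), ShortComplex.moduleCat_exact_iff]
    constructor
    · intro h z hz hδ
      obtain ⟨⟨w, hw⟩, hwz⟩ := h ⟨z, hz⟩ (Subtype.ext hδ)
      exact ⟨w, hw, congrArg Subtype.val hwz⟩
    · rintro h ⟨z, hz⟩ hδ
      obtain ⟨w, hw, hwz⟩ := h z hz (congrArg Subtype.val hδ)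
      exact ⟨⟨w, hw⟩, Subtype.ext hwz⟩

theorem subsingleton_localCoh_iInf_iff {G : GrMod 𝕜 N} (R : InjectiveResolution G)
    (L : List (Finset (Var N))) (m : MDeg N) :
    (∀ i, Subsingleton (((localCoh (⨅ A ∈ L, varIdeal 𝕜 A) i).obj G).obj m)) ↔
      (InjComplex.ofResolution R).Acyclic (powFilt L) m := by
  simp only [subsingleton_localCoh_iff R, torsionPiece_iInf]
  rfl

/-- Without a torsion condition, the complex computes `G` itself. -/
theorem acyclic_annFilt_empty_empty {G : GrMod 𝕜 N} (R : InjectiveResolution G) (m : MDeg N)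
    (h : Subsingleton (G.obj m)) : (InjComplex.ofResolution R).Acyclic (annFilt ∅ ∅) m := by
  have htop : ∀ G' : GrMod 𝕜 N, ∀ x, x ∈ torsBy (annFilt ∅ ∅) G' m := fun G' x =>
    ⟨1, fun n s hs => by simp [mem_annFilt, degOn] at hs⟩
  let ev : GrMod 𝕜 N ⥤ ModuleCat.{u} 𝕜 := (evaluation (MDeg N) (ModuleCat.{u} 𝕜)).obj m
  intro i z _ hδ
  cases i with
  | zero =>
    have hex : (ShortComplex.mk _ _ R.ι_f_zero_comp_complex_d).Exact :=
      ShortComplex.exact_of_f_is_kernel _ R.isLimitKernelFork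
    obtain ⟨x, hx⟩ := (ShortComplex.moduleCat_exact_iff _).1 (hex.map ev) z hδ
    refine ⟨0, zero_mem _, ?_⟩
    rw [map_zero, ← hx, Subsingleton.elim (α := G.obj m) x 0]
    exact (map_zero _).symm
  | succ i =>
    obtain ⟨w, hw⟩ := (ShortComplex.moduleCat_exact_iff _).1 ((R.exact_succ i).map ev) z hδ
    exact ⟨w, htop _ w, hw⟩

/-! ### Finitely generated graded modules are bounded below -/

section

variable {F : Type u} [AddCommGroup F] [Module 𝕜 F] [Module (PolyRing 𝕜 N) F]
  [Module.Finite (PolyRing 𝕜 N) F]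
  (𝓕 : (Fin k → ℤ) → Submodule 𝕜 F) [DirectSum.Decomposition 𝓕]
  [SetLike.GradedSMul (polyGrading 𝕜 N) 𝓕]

theorem exists_forall_lt_eq_bot (φ : (Fin k → ℤ) →+ ℤ) (hφ : ∀ v, 0 ≤ φ (varDeg N v)) :
    ∃ c : ℤ, ∀ m, φ m < c → 𝓕 m = ⊥ := by
  classical
  obtain ⟨T, hT⟩ := Module.Finite.fg_top (R := PolyRing 𝕜 N) (M := F)
  -- a lower bound for the weights of the homogeneous components of the generators
  obtain ⟨c, hc⟩ : ∃ c : ℤ, ∀ d ∈ T.biUnion fun g => (DirectSum.decompose 𝓕 g).support, c ≤ φ d := by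
    obtain ⟨c, hc⟩ := ((T.biUnion fun g => (DirectSum.decompose 𝓕 g).support).image φ).bddBelow
    exact ⟨c, fun d hd => hc (Finset.mem_coe.2 (Finset.mem_image_of_mem φ hd))⟩
  refine ⟨c, fun m hm => ?_⟩
  let V : Submodule 𝕜 F := ⨆ d : {d // c ≤ φ d}, 𝓕 d
  have hmon : ∀ (s : Var N →₀ ℕ) (a : 𝕜), ∀ x ∈ V,
      (MvPolynomial.monomial s a : PolyRing 𝕜 N) • x ∈ V := by
    intro s a x hx
    induction hx using Submodule.iSup_induction' with
    | mem d x hx =>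
      have hs : (MvPolynomial.monomial s a : PolyRing 𝕜 N) ∈ polyGrading 𝕜 N (monDeg N s) :=
        MvPolynomial.isWeightedHomogeneous_monomial _ _ _ rfl
      have hmem := SetLike.GradedSMul.smul_mem (B := 𝓕) hs hx
      have hpos : 0 ≤ φ (monDeg N s) := by
        rw [Finsupp.weight_apply, Finsupp.sum, map_sum]
        refine Finset.sum_nonneg fun v _ => ?_
        rw [map_nsmul]
        exact nsmul_nonneg (hφ v) _
      have hd : c ≤ φ (monDeg N s +ᵥ d.1) := by
        rw [vadd_eq_add, map_add]
        have := d.2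
        lia
      exact Submodule.mem_iSup_of_mem (p := fun d : {d // c ≤ φ d} => 𝓕 d) ⟨_, hd⟩ hmem
    | zero => rw [smul_zero]; exact zero_mem V
    | add x y _ _ hx hy => rw [smul_add]; exact add_mem hx hy
  let W : Submodule (PolyRing 𝕜 N) F :=
    { V.toAddSubmonoid with
      smul_mem' := fun p x hx => by
        change p • x ∈ V
        rw [← MvPolynomial.support_sum_monomial_coeff p, Finset.sum_smul]
        exact sum_mem fun s _ => hmon s _ x hx }
  have hW : W = ⊤ := by
    rw [← top_le_iff, ← hT, Submodule.span_le]
    intro g hg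
    change g ∈ V
    rw [← DirectSum.sum_support_decompose 𝓕 g]
    refine sum_mem fun d hd => Submodule.mem_iSup_of_mem
      (p := fun d : {d // c ≤ φ d} => 𝓕 d)
      ⟨d, hc d (Finset.mem_biUnion.2 ⟨g, hg, hd⟩)⟩ (SetLike.coe_mem _)
  have hdis := (DirectSum.Decomposition.isInternal 𝓕).submodule_iSupIndep m
  have hle : V ≤ ⨆ (d) (_ : d ≠ m), 𝓕 d :=
    iSup_le fun d => le_iSup₂_of_le d.1 (fun h => by have := d.2; rw [h] at this; lia) le_rfl
  refine (Submodule.eq_bot_iff _).2 fun x hx => ?_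
  have hxW : x ∈ W := hW ▸ Submodule.mem_top
  exact Submodule.disjoint_def.1 hdis x hx (hle hxW)

end

/-! ### Unions of blocks of variables -/

/-- The variables in the blocks with index in `J`. -/
def blockVars (N : Fin k → ℕ) (J : Finset (Fin k)) : Finset (Var N) :=
  Finset.univ.filter fun v => v.1 ∈ J

theorem mem_blockVars {J : Finset (Fin k)} {v : Var N} : v ∈ blockVars N J ↔ v.1 ∈ J := by
  simp [blockVars]

theorem blockVars_union (J J' : Finset (Fin k)) :
    blockVars N J ∪ blockVars N J' = blockVars N (J ∪ J') := by
  ext v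
  simp [mem_blockVars]

theorem iSup_blockIdeal (J : Finset (Fin k)) :
    ⨆ j ∈ J, blockIdeal 𝕜 N j = varIdeal 𝕜 (blockVars N J) := by
  simp only [blockIdeal, varIdeal, ← Ideal.span_iUnion]
  congr 1
  ext p
  simp only [Set.mem_iUnion, Set.mem_range, Set.mem_image, Finset.mem_coe, mem_blockVars]
  constructor
  · rintro ⟨l, hl, j, rfl⟩
    exact ⟨⟨l, j⟩, hl, rfl⟩
  · rintro ⟨⟨l, j⟩, hl, rfl⟩
    exact ⟨l, hl, j, rfl⟩

theorem maxIdeal_eq : maxIdeal 𝕜 N = ⨅ A ∈ [Finset.univ], varIdeal 𝕜 (A : Finset (Var N)) := by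
  have h := iSup_blockIdeal (𝕜 := 𝕜) (N := N) Finset.univ
  have huniv : blockVars N Finset.univ = Finset.univ := by
    ext v
    simp [mem_blockVars]
  rw [huniv] at h
  simpa [maxIdeal] using h

theorem mixedIdeal_eq (I J : Finset (Fin k)) : ∃ L : List (Finset (Var N)),
    mixedIdeal 𝕜 N I J = ⨅ A ∈ L, varIdeal 𝕜 A ∧
      ∀ A ∈ L, ∃ J' : Finset (Fin k), J'.Nonempty ∧ A = blockVars N J' := by
  have hI : ⨅ i ∈ I, blockIdeal 𝕜 N i =
      ⨅ A ∈ I.toList.map fun i => blockVars N {i}, varIdeal 𝕜 A := by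
    have h : ∀ i, blockIdeal 𝕜 N i = varIdeal 𝕜 (blockVars N {i}) := fun i => by
      rw [← iSup_blockIdeal, Finset.iSup_singleton]
    refine le_antisymm (le_iInf₂ fun A hA => ?_) (le_iInf₂ fun i hi => ?_)
    · obtain ⟨i, hi, rfl⟩ := List.mem_map.1 hA
      rw [← h]
      exact iInf₂_le i (Finset.mem_toList.1 hi)
    · rw [h]
      exact iInf₂_le _ (List.mem_map_of_mem (Finset.mem_toList.2 hi))
  have hL : ∀ A ∈ I.toList.map fun i => blockVars N {i},
      ∃ J' : Finset (Fin k), J'.Nonempty ∧ A = blockVars N J' := fun A hA => by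
    obtain ⟨i, -, rfl⟩ := List.mem_map.1 hA
    exact ⟨{i}, Finset.singleton_nonempty i, rfl⟩
  by_cases hJ : J = ∅
  · exact ⟨_, by rw [mixedIdeal, if_pos hJ, inf_top_eq, hI], hL⟩
  · refine ⟨blockVars N J :: I.toList.map fun i => blockVars N {i}, ?_, fun A hA => ?_⟩
    · rw [mixedIdeal, if_neg hJ, hI, iSup_blockIdeal, inf_comm]
      simp only [List.mem_cons, iInf_or, iInf_inf_eq, iInf_iInf_eq_left]
    · rcases List.mem_cons.1 hA with rfl | hA
      · exact ⟨J, Finset.nonempty_iff_ne_empty.2 hJ, rfl⟩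
      · exact hL A hA

/-! ### The vanishing theorem -/

section

variable {F : Type u} [AddCommGroup F] [Module 𝕜 F] [Module (PolyRing 𝕜 N) F]
  [IsScalarTower 𝕜 (PolyRing 𝕜 N) F]
  (𝓕 : (Fin k → ℤ) → Submodule 𝕜 F) [SetLike.GradedSMul (polyGrading 𝕜 N) 𝓕]

theorem lt_of_aStar_add_one_le {n : Fin k → ℤ} {l : Fin k}
    (hn : aStar N 𝓕 l + 1 ≤ ((n l : WithTop ℤ) : WithBot (WithTop ℤ))) {i : ℕ} {m : Fin k → ℤ}
    (hm : Nontrivial (localCohPiece N 𝓕 (maxIdeal 𝕜 N) i m)) : m l < n l := by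
  have h : ((m l : WithTop ℤ) : WithBot (WithTop ℤ)) ≤ aStar N 𝓕 l :=
    (le_iSup₂_of_le m hm le_rfl : _ ≤ aInv N 𝓕 l i).trans (le_iSup (aInv N 𝓕 l) i)
  have h' : (((m l + 1 : ℤ) : WithTop ℤ) : WithBot (WithTop ℤ)) ≤
      ((n l : WithTop ℤ) : WithBot (WithTop ℤ)) := (add_le_add_left h 1).trans hn
  exact Int.lt_of_add_one_le (WithTop.coe_le_coe.1 (WithBot.coe_le_coe.1 h'))

/-- If `n` is beyond the `a^*`-invariant vector, the torsion elements with respect to the variables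
of a non-empty set of blocks form an acyclic complex in degree `n`. -/
theorem acyclic_powFilt_blockVars [Module.Finite (PolyRing 𝕜 N) F] [DirectSum.Decomposition 𝓕]
    (R : InjectiveResolution (toGrMod N 𝓕)) {n : Fin k → ℤ}
    (hn : ∀ l, aStar N 𝓕 l + 1 ≤ ((n l : WithTop ℤ) : WithBot (WithTop ℤ)))
    {J : Finset (Fin k)} (hJ : J.Nonempty) :
    (InjComplex.ofResolution R).Acyclic (powFilt [blockVars N J]) ⟨n⟩ := by
  obtain ⟨j, hj⟩ := hJ
  -- the weight `φ` counts the degrees in the blocks outside `J`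
  let φ : (Fin k → ℤ) →+ ℤ := ∑ l ∈ Jᶜ, Pi.evalAddMonoidHom (fun _ => ℤ) l
  have hφ : ∀ v : Var N, φ (varDeg N v) = if v.1 ∈ J then 0 else 1 := fun v => by
    simp only [φ, AddMonoidHom.finsetSum_apply, Pi.evalAddMonoidHom_apply, varDeg,
      Finset.sum_pi_single', Finset.mem_compl]
    split_ifs <;> simp_all
  obtain ⟨c, hc⟩ := exists_forall_lt_eq_bot 𝓕 φ fun v => by rw [hφ]; split_ifs <;> simp
  rw [← InjComplex.acyclic_congr fun G => torsBy_annFilt_empty _ G _]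
  have hdeg : ∀ v ∉ blockVars N J, varDeg N v j = 0 := fun v hv =>
    Pi.single_eq_of_ne (by rintro rfl; exact hv (mem_blockVars.2 hj)) _
  refine InjComplex.acyclic_of_acyclic_univ (D := {m | n j ≤ m.deg j}) φ (fun v hv => ?_)
    (fun v hv => ?_) (c := c) (fun m hm => ?_) (fun v hv m hm => ?_) (fun v hv m hm => ?_)
    (fun m hm => ?_) (le_refl (n j))
  · rw [hφ, if_pos (mem_blockVars.1 hv)]
  · rw [hφ, if_neg (mem_blockVars.not.1 hv)]
  · refine acyclic_annFilt_empty_empty R m ?_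
    change Subsingleton (𝓕 m.deg)
    rw [hc _ hm]
    infer_instance
  · change n j ≤ m.deg j + varDeg N v j
    rwa [hdeg v hv, add_zero]
  · change n j ≤ m.deg j - varDeg N v j
    rwa [hdeg v hv, sub_zero]
  · rw [InjComplex.acyclic_congr fun G => torsBy_annFilt_empty _ G _,
      ← subsingleton_localCoh_iInf_iff, ← maxIdeal_eq]
    intro i
    by_contra h
    exact not_lt.2 hm
      (lt_of_aStar_add_one_le 𝓕 (hn j) (i := i) (not_subsingleton_iff_nontrivial.1 h))

end

end MultigradedLC

theorem theorem3p2p6 {𝕜 : Type u} [Field 𝕜] {k : ℕ} (N : Fin k → ℕ)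
    {F : Type u} [AddCommGroup F] [Module 𝕜 F] [Module (MultigradedLC.PolyRing 𝕜 N) F]
    [IsScalarTower 𝕜 (MultigradedLC.PolyRing 𝕜 N) F] [Module.Finite (MultigradedLC.PolyRing 𝕜 N) F]
    (𝓕 : (Fin k → ℤ) → Submodule 𝕜 F) [DirectSum.Decomposition 𝓕]
    [SetLike.GradedSMul (MultigradedLC.polyGrading 𝕜 N) 𝓕]
    (n : Fin k → ℤ)
    (hn : ∀ l, MultigradedLC.aStar N 𝓕 l + 1 ≤ ((n l : WithTop ℤ) : WithBot (WithTop ℤ)))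
    (i : ℕ) (I J : Finset (Fin k)) (hIJ : Disjoint I J) :
    Subsingleton
      (MultigradedLC.localCohPiece N 𝓕 (MultigradedLC.mixedIdeal 𝕜 N I J) i n) := by
  obtain ⟨L, hL, hL'⟩ := MultigradedLC.mixedIdeal_eq (𝕜 := 𝕜) (N := N) I J
  have R := CategoryTheory.injectiveResolution (MultigradedLC.toGrMod N 𝓕)
  rw [hL]
  refine (MultigradedLC.subsingleton_localCoh_iInf_iff R L ⟨n⟩).2
    (MultigradedLC.InjComplex.acyclic_powFilt_of_forall
      (S := {A | ∃ J' : Finset (Fin k), J'.Nonempty ∧ A = MultigradedLC.blockVars N J'})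
      ?_ ?_ L hL') i
  · rintro _ ⟨J₁, h₁, rfl⟩ _ ⟨J₂, -, rfl⟩
    exact ⟨J₁ ∪ J₂, h₁.mono Finset.subset_union_left, MultigradedLC.blockVars_union J₁ J₂⟩
  · rintro _ ⟨J', hJ', rfl⟩
    exact MultigradedLC.acyclic_powFilt_blockVars 𝓕 R hn hJ'
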